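/- Let $\mathbb S^2\subset\mathbb R^3$ be the unit sphere with its surface measure $dV$, and let $\mathrm{SL}(3)$, the group of real $3\times3$ matrices of determinant one, act on $\mathbb S^2$ by $\rho_H(x)=\rho(H,x)=H^{-1}x/|H^{-1}x|$. Let $\mathcal X\subset\mathbb S^2$ be open and let $\mathring I\in W^{2,2}(\mathcal X)$ be a real-valued function (the reference image), i.e. $\mathring I$, its weak gradient $\tilde\nabla\mathring I$ (a tangential vector field, regarded as a field with values in $\mathbb R^3$) and its weak covariant Hessian $\tilde\nabla^2\mathring I$ exist and are square-integrable on $\mathcal X$. For $E\in\mathrm{SL}(3)$ let $I^e$ be the function on $\mathcal X$ equal to $\mathring I(\rho_E(x))$ if $\rho_E(x)\in\mathcal X$ and to $0$ otherwise, and put $$\mathcal C(E)=\tfrac12\int_{\mathcal X}\bigl(I^e(x)-\mathring I(x)\bigr)^2\,dV(x).$$ Suppose that for every nonzero real $3\times3$ matrix $\Delta$ of trace zero there is a measurable set $\mathcal U\subset\mathcal X$ of positive measure with $$\int_{\mathcal U}\bigl\langle\tilde\nabla\mathring I(x)\,x^\top,\Delta\bigr\rangle^2\,dV(x)>0,$$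 where $\langle A,B\rangle=\operatorname{tr}(A^\top B)$. Then $\mathcal C$ has an isolated global minimum at the identity matrix $I_3$: $\mathcal C(E)\ge\mathcal C(I_3)$ for all $E\in\mathrm{SL}(3)$, and there is a neighbourhood $N$ of $I_3$ in $\mathrm{SL}(3)$ such that $\mathcal C(E)>\mathcal C(I_3)$ for all $E\in N\setminus\{I_3\}$. -/

import Mathlib

open MeasureTheory Metric Topology
open scoped ContDiff RealInnerProductSpace

namespace Homography

/-- Three-dimensional Euclidean space. -/
abbrev E3 : Type := EuclideanSpace ℝ (Fin 3)

/-- The unit sphere of three-dimensional Euclidean space. -/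
abbrev S2 : Type := sphere (0 : E3) 1

/-- The surface area measure `dV` on the unit sphere (of total mass `4π`). -/
noncomputable abbrev area : Measure S2 := (volume : Measure E3).toSphere

/-- The standard basis of three-dimensional Euclidean space. -/
noncomputable abbrev stdVec (i : Fin 3) : E3 := EuclideanSpace.single i 1

/-! ### The action of `SL(3)` on the sphere -/

theorem inv_mulVec_ne_zero (H : Matrix.SpecialLinearGroup (Fin 3) ℝ) (x : S2) :
    Matrix.toEuclideanLin (H⁻¹).1 (x : E3) ≠ 0 := by
  intro h
  have h1 : (H⁻¹).1.mulVec (x : E3).ofLp = 0 := congrArg WithLp.ofLp h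
  have h2 : H.1.mulVec ((H⁻¹).1.mulVec (x : E3).ofLp) = (x : E3).ofLp := by
    rw [Matrix.mulVec_mulVec, ← Matrix.SpecialLinearGroup.coe_mul, mul_inv_cancel,
      Matrix.SpecialLinearGroup.coe_one, Matrix.one_mulVec]
  rw [h1, Matrix.mulVec_zero] at h2
  have h3 : (x : E3) = 0 := by
    ext i
    exact (congrFun h2 i).symm
  have h4 : ‖(x : E3)‖ = 1 := norm_eq_of_mem_sphere x
  rw [h3, norm_zero] at h4
  exact zero_ne_one h4

/-- The action `ρ(H, x) = H⁻¹ x / |H⁻¹ x|` of `SL(3)` on the unit sphere. -/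
noncomputable def rho (H : Matrix.SpecialLinearGroup (Fin 3) ℝ) (x : S2) : S2 :=
  ⟨‖Matrix.toEuclideanLin (H⁻¹).1 (x : E3)‖⁻¹ • Matrix.toEuclideanLin (H⁻¹).1 (x : E3), by
    rw [mem_sphere_zero_iff_norm, norm_smul, norm_inv, norm_norm]
    exact inv_mul_cancel₀ (norm_ne_zero_iff.mpr (inv_mulVec_ne_zero H x))⟩

/-! ### Weak covariant derivatives on the sphere

Smooth tensor fields on the sphere are represented by (restrictions to the sphere of) smooth maps
on the ambient space whose values at points of the sphere are tangential. Every smooth tensor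
field on the sphere is of this form. A covariant 2-tensor `T` at a point is represented by the
linear map with `T(u, v) = ⟪T u, v⟫`. Only derivatives in tangential directions at points of the
sphere occur below, so that nothing depends on the chosen extension. -/

/-- For `x` on the unit sphere, the orthogonal projection `π_x v = v - ⟪x, v⟫ x` onto the
tangent space of the sphere at `x`. -/
noncomputable def tangentProj (x v : E3) : E3 := v - ⟪x, v⟫ • x

/-- The Riemannian divergence on the sphere of a tangential vector field `Φ`:
the sum of `⟪∇_u Φ, u⟫` over an orthonormal basis of tangent vectors `u`. -/
noncomputable def surfaceDiv (Φ : E3 → E3) (x : E3) : ℝ :=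
  ∑ i : Fin 3, ⟪fderiv ℝ Φ x (tangentProj x (stdVec i)), tangentProj x (stdVec i)⟫

/-- The Riemannian divergence on the sphere of a tangential 2-tensor field `Φ`: the vector field
given by the sum of `(∇_u Φ)(u, ·)` over an orthonormal basis of tangent vectors `u`. -/
noncomputable def surfaceTensorDiv (Φ : E3 → E3 →L[ℝ] E3) (x : E3) : E3 :=
  tangentProj x
    (∑ i : Fin 3, fderiv ℝ Φ x (tangentProj x (stdVec i)) (tangentProj x (stdVec i)))

/-- A linear map represents a tangential 2-tensor at the point `x` of the sphere. -/
def IsTangentTensor (x : E3) (T : E3 →L[ℝ] E3) : Prop :=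
  T x = 0 ∧ ∀ u : E3, ⟪T u, x⟫ = 0

/-- The inner product `tr(Sᵀ T)` of 2-tensors. -/
noncomputable def tensorInner (S T : E3 →L[ℝ] E3) : ℝ :=
  ∑ i : Fin 3, ⟪S (stdVec i), T (stdVec i)⟫

/-- Smooth tangential vector fields on the sphere with compact support in the set `X`
(the sphere being compact, the closed set `tsupport` is compact). -/
def IsTestField (X : Set S2) (Φ : E3 → E3) : Prop :=
  ContDiff ℝ ∞ Φ ∧ (∀ x : S2, ⟪Φ x, (x : E3)⟫ = 0) ∧ tsupport (fun x : S2 => Φ x) ⊆ X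

/-- Smooth tangential 2-tensor fields on the sphere with compact support in the set `X`. -/
def IsTestTensor (X : Set S2) (Φ : E3 → E3 →L[ℝ] E3) : Prop :=
  ContDiff ℝ ∞ Φ ∧ (∀ x : S2, IsTangentTensor x (Φ x)) ∧ tsupport (fun x : S2 => Φ x) ⊆ X

/-- `G` is a weak gradient on `X` of the function `f`. -/
def IsWeakGradient (X : Set S2) (f : S2 → ℝ) (G : S2 → E3) : Prop :=
  LocallyIntegrableOn f X area ∧ LocallyIntegrableOn G X area ∧
  (∀ᵐ (x : S2) ∂(area.restrict X), ⟪G x, (x : E3)⟫ = 0) ∧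
  ∀ Φ : E3 → E3, IsTestField X Φ →
    ∫ x in X, f x * surfaceDiv Φ x ∂area = -∫ x in X, ⟪G x, Φ x⟫ ∂area

/-- `S` is a weak Hessian (second covariant derivative) on `X` of the function `f`. -/
def IsWeakHessian (X : Set S2) (f : S2 → ℝ) (S : S2 → E3 →L[ℝ] E3) : Prop :=
  LocallyIntegrableOn f X area ∧ LocallyIntegrableOn S X area ∧
  (∀ᵐ (x : S2) ∂(area.restrict X), IsTangentTensor x (S x)) ∧
  ∀ Φ : E3 → E3 →L[ℝ] E3, IsTestTensor X Φ →
    ∫ x in X, f x * surfaceDiv (surfaceTensorDiv Φ) x ∂area =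
      ∫ x in X, tensorInner (S x) (Φ x) ∂area

/-- The Sobolev space `W^{2,2}(X)`: square-integrable functions whose weak derivatives of order
one and two exist and are square-integrable. -/
def MemW22 (X : Set S2) (f : S2 → ℝ) : Prop :=
  MemLp f 2 (area.restrict X) ∧
  (∃ G : S2 → E3, IsWeakGradient X f G ∧ MemLp G 2 (area.restrict X)) ∧
  (∃ S : S2 → E3 →L[ℝ] E3, IsWeakHessian X f S ∧ MemLp S 2 (area.restrict X))

/-! ### The photometric cost -/

open Classical in
/-- The warped image `f ∘ ρ_E` of an image `f` with domain `X`, extended by zero where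
`f ∘ ρ_E` is not defined. -/
noncomputable def warpedImage (X : Set S2) (f : S2 → ℝ)
    (E : Matrix.SpecialLinearGroup (Fin 3) ℝ) (x : S2) : ℝ :=
  if rho E x ∈ X then f (rho E x) else 0

/-- The photometric cost `C(E) = ½ ‖f ∘ ρ_E - f‖²`, with the norm of `L²(X)`. -/
noncomputable def photometricCost (X : Set S2) (f : S2 → ℝ)
    (E : Matrix.SpecialLinearGroup (Fin 3) ℝ) : ℝ :=
  (1 / 2) * ∫ x in X, (warpedImage X f E x - f x) ^ 2 ∂area

/-- The Frobenius inner product `⟨A, B⟩ = tr(Aᵀ B)` of matrices. -/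
def frobeniusInner (A B : Matrix (Fin 3) (Fin 3) ℝ) : ℝ := (A.transpose * B).trace

end Homography

namespace Homography

open Matrix Filter Set

/-! The cost is nonnegative and vanishes at the identity, so only isolation needs an argument. If it
fails, there are `E n ≠ 1` tending to `1` with cost zero, i.e. warps that fix the image almost
everywhere on `X`. By compactness a subsequence has the form `E n = 1 + ε n • A n` with `ε n → 0`
and `A n → Δ ≠ 0`; expanding `det (E n) = 1` gives `tr Δ = 0` (`exists_tangent_direction`).

Invariance is differentiated weakly, with the derivative put on a smooth function `g` whose
restriction to the sphere is supported in `X`. The warp has Jacobian density `|E y|⁻³`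
(`map_rho_area`), so extending `g` homogeneously of degree `-3` to `ĝ` turns invariance into `∫ f(y)
ĝ(E n y) = ∫ f g`. The limit of difference quotients is `∫ f(y) Dĝ(y)(Δ y) = 0`. As `tr Δ = 0`, the
second factor is the surface divergence of `g` times the tangential part of `Δ y`, so the definition
of the weak gradient gives `∫ g ⟪G, Δ y⟫ = 0`. Since `g` is arbitrary, `⟪G, Δ y⟫ = 0` almost
everywhere on `X`, against the hypothesis on `Δ`. -/

/-! ### The warps as homeomorphisms of the sphere -/

theorem toEuclideanLin_inv_apply_self (E : Matrix.SpecialLinearGroup (Fin 3) ℝ) (x : E3) :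
    toEuclideanLin (E⁻¹).1 (toEuclideanLin E.1 x) = x := by
  have h : (E⁻¹).1.mulVec (E.1.mulVec x.ofLp) = x.ofLp := by
    rw [mulVec_mulVec, ← Matrix.SpecialLinearGroup.coe_mul, inv_mul_cancel,
      Matrix.SpecialLinearGroup.coe_one, one_mulVec]
  ext i
  exact congrFun h i

theorem toEuclideanLin_self_apply_inv (E : Matrix.SpecialLinearGroup (Fin 3) ℝ) (x : E3) :
    toEuclideanLin E.1 (toEuclideanLin (E⁻¹).1 x) = x := by
  simpa using toEuclideanLin_inv_apply_self E⁻¹ x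

theorem toEuclideanLin_ne_zero (E : Matrix.SpecialLinearGroup (Fin 3) ℝ) {x : E3} (hx : x ≠ 0) :
    toEuclideanLin E.1 x ≠ 0 := by
  intro h
  apply hx
  rw [← toEuclideanLin_inv_apply_self E x, h, map_zero]

theorem coe_rho (E : Matrix.SpecialLinearGroup (Fin 3) ℝ) (x : S2) :
    (rho E x : E3) =
      ‖toEuclideanLin (E⁻¹).1 (x : E3)‖⁻¹ • toEuclideanLin (E⁻¹).1 (x : E3) := rfl

theorem continuous_rho (E : Matrix.SpecialLinearGroup (Fin 3) ℝ) : Continuous (rho E) := by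
  have h : Continuous fun x : S2 => toEuclideanLin (E⁻¹).1 (x : E3) :=
    (LinearMap.continuous_of_finiteDimensional _).comp continuous_subtype_val
  exact Continuous.subtype_mk
    ((h.norm.inv₀ fun x => norm_ne_zero_iff.mpr (inv_mulVec_ne_zero E x)).smul h) _

theorem rho_one (x : S2) : rho 1 x = x := by
  ext1
  have : toEuclideanLin ((1 : Matrix.SpecialLinearGroup (Fin 3) ℝ)⁻¹).1 (x : E3) = x := by
    simp
  rw [coe_rho, this, norm_eq_of_mem_sphere, inv_one, one_smul]

theorem rho_inv_rho (E : Matrix.SpecialLinearGroup (Fin 3) ℝ) (x : S2) :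
    rho E⁻¹ (rho E x) = x := by
  ext1
  have h0 := norm_pos_iff.mpr (inv_mulVec_ne_zero E x)
  rw [coe_rho, coe_rho, inv_inv, map_smul, toEuclideanLin_self_apply_inv, norm_smul, norm_inv,
    norm_norm, norm_eq_of_mem_sphere, mul_one, inv_inv, smul_smul, mul_inv_cancel₀ h0.ne',
    one_smul]

/-! ### Change of variables under a warp -/

/-- The set of nonzero vectors whose polar coordinates lie in a given set. -/
def cone (T : Set (S2 × Ioi (0 : ℝ))) : Set E3 :=
  (↑) '' (homeomorphUnitSphereProd E3 ⁻¹' T)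

theorem mem_cone {T : Set (S2 × Ioi (0 : ℝ))} {z : E3} :
    z ∈ cone T ↔ ∃ h : z ∈ ({0}ᶜ : Set E3), homeomorphUnitSphereProd E3 ⟨z, h⟩ ∈ T := by
  simp [cone]

theorem volume_cone {T : Set (S2 × Ioi (0 : ℝ))} (hT : MeasurableSet T) :
    volume (cone T) = (area.prod (Measure.volumeIoiPow 2)) T := by
  have h := (volume : Measure E3).measurePreserving_homeomorphUnitSphereProd
  have hd : Module.finrank ℝ E3 - 1 = 2 := by simp
  rw [hd] at h
  rw [← h.measure_preimage hT.nullMeasurableSet,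
    comap_subtype_coe_apply (measurableSet_singleton _).compl, cone]

theorem det_toEuclideanLin (E : Matrix.SpecialLinearGroup (Fin 3) ℝ) :
    LinearMap.det (toEuclideanLin E.1) = 1 := by
  rw [toEuclideanLin_eq_toLin_orthonormal, LinearMap.det_toLin, E.2]

/-- The density of the image of the area measure under `rho E`. -/
noncomputable def rhoDensity (E : Matrix.SpecialLinearGroup (Fin 3) ℝ) (y : S2) : ℝ :=
  (‖toEuclideanLin E.1 (y : E3)‖⁻¹) ^ 3

theorem continuous_rhoDensity (E : Matrix.SpecialLinearGroup (Fin 3) ℝ) :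
    Continuous (rhoDensity E) := by
  have h : Continuous fun x : S2 => toEuclideanLin E.1 (x : E3) :=
    (LinearMap.continuous_of_finiteDimensional _).comp continuous_subtype_val
  refine (h.norm.inv₀ fun x => norm_ne_zero_iff.mpr (toEuclideanLin_ne_zero E ?_)).pow 3
  exact ne_zero_of_mem_unit_sphere x

theorem rhoDensity_nonneg (E : Matrix.SpecialLinearGroup (Fin 3) ℝ) (y : S2) :
    0 ≤ rhoDensity E y := by
  unfold rhoDensity; positivity

/-- Area is read off from volumes of cones. The volume-preserving map `E⁻¹` carries the unit-height
cone over `rho E ⁻¹' s` onto the cone over `s` cut off at radius `|E y|⁻¹` in direction `y`.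
Integrating `r² dr` gives `1/3` on one side and `|E y|⁻³ / 3` on the other. -/
theorem map_rho_area (E : Matrix.SpecialLinearGroup (Fin 3) ℝ) :
    area.map (rho E) = area.withDensity fun y => ENNReal.ofReal (rhoDensity E y) := by
  ext s hs
  have hn : ∀ y : S2, 0 < ‖toEuclideanLin E.1 (y : E3)‖ := fun y =>
    norm_pos_iff.mpr (toEuclideanLin_ne_zero E (ne_zero_of_mem_unit_sphere y))
  rw [Measure.map_apply (continuous_rho E).measurable hs, withDensity_apply _ hs]
  have hs' : MeasurableSet (rho E ⁻¹' s) := (continuous_rho E).measurable hs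
  let T₁ : Set (S2 × Ioi (0 : ℝ)) := (rho E ⁻¹' s) ×ˢ Iio ⟨1, mem_Ioi.2 one_pos⟩
  let T₂ : Set (S2 × Ioi (0 : ℝ)) :=
    {p | p.1 ∈ s ∧ (p.2 : ℝ) * ‖toEuclideanLin E.1 (p.1 : E3)‖ < 1}
  have hT₁ : MeasurableSet T₁ := hs'.prod measurableSet_Iio
  have hcont : Continuous fun p : S2 × Ioi (0 : ℝ) =>
      (p.2 : ℝ) * ‖toEuclideanLin E.1 (p.1 : E3)‖ :=
    (continuous_subtype_val.comp continuous_snd).mul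
      ((LinearMap.continuous_of_finiteDimensional (toEuclideanLin E.1)).comp
        (continuous_subtype_val.comp continuous_fst)).norm
  have hT₂ : MeasurableSet T₂ :=
    (measurable_fst hs).inter (measurableSet_lt hcont.measurable measurable_const)
  have hcone : cone T₁ = toEuclideanLin (E⁻¹).1 ⁻¹' cone T₂ := by
    ext z
    rw [mem_preimage, mem_cone, mem_cone]
    by_cases hz : z = 0
    · simp [hz]
    have hz' : 0 < ‖z‖ := norm_pos_iff.mpr hz
    have hw : toEuclideanLin (E⁻¹).1 z ≠ 0 := toEuclideanLin_ne_zero E⁻¹ hz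
    have hw' : 0 < ‖toEuclideanLin (E⁻¹).1 z‖ := norm_pos_iff.mpr hw
    have key : rho E (homeomorphUnitSphereProd E3 ⟨z, hz⟩).1 =
        (homeomorphUnitSphereProd E3 ⟨toEuclideanLin (E⁻¹).1 z, hw⟩).1 := by
      ext1
      simp only [coe_rho, homeomorphUnitSphereProd_apply_fst_coe, map_smul, norm_smul, norm_inv,
        norm_norm, mul_inv, inv_inv, smul_smul]
      congr 1
      field_simp
    have key2 : ((homeomorphUnitSphereProd E3 ⟨toEuclideanLin (E⁻¹).1 z, hw⟩).2 : ℝ) *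
        ‖toEuclideanLin E.1
          ((homeomorphUnitSphereProd E3 ⟨toEuclideanLin (E⁻¹).1 z, hw⟩).1 : E3)‖ = ‖z‖ := by
      simp only [homeomorphUnitSphereProd_apply_fst_coe, homeomorphUnitSphereProd_apply_snd_coe,
        map_smul, norm_smul, toEuclideanLin_self_apply_inv, norm_inv, norm_norm]
      field_simp
    have e1 : homeomorphUnitSphereProd E3 ⟨z, hz⟩ ∈ T₁ ↔
        homeomorphUnitSphereProd E3 ⟨toEuclideanLin (E⁻¹).1 z, hw⟩ ∈ T₂ := by
      simp only [T₁, T₂, mem_prod, mem_preimage, mem_ofPred_eq, key, key2, mem_Iio,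
        ← Subtype.coe_lt_coe]
      rw [homeomorphUnitSphereProd_apply_snd_coe]
    exact ⟨fun ⟨_, h⟩ => ⟨hw, e1.1 h⟩, fun ⟨_, h⟩ => ⟨hz, e1.2 h⟩⟩
  have hvol : volume (cone T₁) = volume (cone T₂) := by
    rw [hcone, Measure.addHaar_preimage_linearMap volume (by rw [det_toEuclideanLin]; norm_num),
      det_toEuclideanLin]
    simp
  rw [volume_cone hT₁, volume_cone hT₂, Measure.prod_prod, Measure.volumeIoiPow_apply_Iio,
    Measure.prod_apply hT₂] at hvol
  have hslice : ∀ y : S2, Measure.volumeIoiPow 2 (Prod.mk y ⁻¹' T₂) =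
      s.indicator (fun y => ENNReal.ofReal (rhoDensity E y) * ENNReal.ofReal (1 / 3)) y := by
    intro y
    by_cases hy : y ∈ s
    · have : Prod.mk y ⁻¹' T₂ =
          Iio ⟨‖toEuclideanLin E.1 (y : E3)‖⁻¹, inv_pos.mpr (hn y)⟩ := by
        ext r
        simp only [T₂, mem_preimage, mem_ofPred_eq, hy, true_and, mem_Iio, ← Subtype.coe_lt_coe]
        rw [lt_inv_comm₀ r.2 (hn y), ← one_div, lt_div_iff₀' r.2]
      rw [this, Measure.volumeIoiPow_apply_Iio, indicator_of_mem hy,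
        ← ENNReal.ofReal_mul (rhoDensity_nonneg E y)]
      congr 1
      simp only [rhoDensity]
      norm_num
      ring
    · have : Prod.mk y ⁻¹' T₂ = ∅ := by
        ext r
        simp [T₂, hy]
      rw [this, indicator_of_notMem hy, measure_empty]
  simp_rw [hslice] at hvol
  rw [lintegral_indicator hs, lintegral_mul_const _
    (continuous_rhoDensity E).measurable.ennreal_ofReal] at hvol
  have h3 : ENNReal.ofReal (1 / 3) ≠ 0 := by simp
  refine (ENNReal.mul_left_inj h3 ENNReal.ofReal_ne_top).1 ?_
  rw [← hvol]
  norm_num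

theorem isHomeomorph_rho (E : Matrix.SpecialLinearGroup (Fin 3) ℝ) : IsHomeomorph (rho E) := by
  refine (Homeomorph.mk ⟨rho E, rho E⁻¹, rho_inv_rho E, fun x => ?_⟩ (continuous_rho E)
    (continuous_rho E⁻¹)).isHomeomorph
  simpa using rho_inv_rho E⁻¹ x

theorem integral_comp_rho (E : Matrix.SpecialLinearGroup (Fin 3) ℝ) (g : S2 → ℝ) :
    ∫ x, g (rho E x) ∂area = ∫ y, rhoDensity E y * g y ∂area := by
  have h := (isHomeomorph_rho E).homeomorph.measurableEmbedding.integral_map (μ := area) g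
  change ∫ y, g y ∂(area.map (rho E)) = ∫ x, g (rho E x) ∂area at h
  rw [← h, map_rho_area, integral_withDensity_eq_integral_toReal_smul
    (continuous_rhoDensity E).measurable.ennreal_ofReal (by simp)]
  simp [ENNReal.toReal_ofReal (rhoDensity_nonneg E _)]

theorem map_rho_area_le (E : Matrix.SpecialLinearGroup (Fin 3) ℝ) :
    ∃ c : ENNReal, c ≠ ⊤ ∧ area.map (rho E) ≤ c • area := by
  obtain ⟨C, hC⟩ := isCompact_univ.exists_bound_of_continuousOn
    (continuous_rhoDensity E).continuousOn
  refine ⟨ENNReal.ofReal C, ENNReal.ofReal_ne_top, ?_⟩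
  rw [map_rho_area, ← withDensity_const]
  refine withDensity_mono (Eventually.of_forall fun y => ENNReal.ofReal_le_ofReal ?_)
  exact (le_abs_self _).trans (hC y (mem_univ y))

theorem memLp_comp_rho {g : S2 → ℝ} {p : ENNReal} (hg : MemLp g p area)
    (E : Matrix.SpecialLinearGroup (Fin 3) ℝ) : MemLp (fun x => g (rho E x)) p area := by
  obtain ⟨c, hc, hle⟩ := map_rho_area_le E
  exact (hg.of_measure_le_smul hc hle).comp_of_map (continuous_rho E).aemeasurable

/-! ### Tangential projection and surface divergence -/

theorem sum_inner_stdVec_smul (v : E3) : ∑ i, ⟪stdVec i, v⟫ • stdVec i = v := by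
  have h := (EuclideanSpace.basisFun (Fin 3) ℝ).sum_repr' v
  simpa only [EuclideanSpace.basisFun_apply] using h

theorem inner_tangentProj_self {x : E3} (hx : ‖x‖ = 1) (v : E3) : ⟪tangentProj x v, x⟫ = 0 := by
  rw [tangentProj, inner_sub_left, inner_smul_left, real_inner_self_eq_norm_sq, hx,
    real_inner_comm x v]
  simp

theorem inner_tangentProj_tangentProj {x : E3} (hx : ‖x‖ = 1) (v w : E3) :
    ⟪tangentProj x v, tangentProj x w⟫ = ⟪tangentProj x v, w⟫ := by
  nth_rw 2 [tangentProj]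
  rw [inner_sub_right, inner_smul_right, inner_tangentProj_self hx]
  simp

/-- For `x` on the sphere, the projected standard basis is a Parseval frame of the tangent plane,
which is why sums over it compute tangential traces. -/
theorem sum_inner_tangentProj_smul (x v : E3) :
    ∑ i, ⟪stdVec i, v⟫ • tangentProj x (stdVec i) = tangentProj x v := by
  simp only [tangentProj, smul_sub, Finset.sum_sub_distrib, sum_inner_stdVec_smul, smul_smul,
    ← Finset.sum_smul]
  congr 2
  conv_rhs => rw [← sum_inner_stdVec_smul v]
  rw [inner_sum]
  simp only [inner_smul_right]

theorem sum_inner_map_tangentProj {x : E3} (hx : ‖x‖ = 1) (A : E3 →L[ℝ] E3) :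
    ∑ i, ⟪A (tangentProj x (stdVec i)), tangentProj x (stdVec i)⟫ =
      ∑ i, ⟪A (stdVec i), stdVec i⟫ - ⟪x, A x⟫ := by
  have h1 : ∑ i, ⟪x, stdVec i⟫ * ⟪A (stdVec i), x⟫ = ⟪A x, x⟫ := by
    conv_rhs => rw [← sum_inner_stdVec_smul x]
    rw [map_sum, sum_inner_stdVec_smul, sum_inner]
    simp only [map_smul, inner_smul_left, real_inner_comm, conj_trivial]
  have h2 : ∑ i, ⟪x, stdVec i⟫ * ⟪A x, stdVec i⟫ = ⟪A x, x⟫ := by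
    conv_rhs => enter [3]; rw [← sum_inner_stdVec_smul x]
    rw [inner_sum]
    simp only [inner_smul_right, real_inner_comm]
  have h3 : ∑ i, ⟪x, stdVec i⟫ * ⟪x, stdVec i⟫ = 1 := by
    have : ⟪x, x⟫ = 1 := by rw [real_inner_self_eq_norm_sq, hx, one_pow]
    rw [← this]
    conv_rhs => enter [3]; rw [← sum_inner_stdVec_smul x]
    rw [inner_sum]
    simp only [inner_smul_right, real_inner_comm]
  have h : ∀ i, ⟪A (tangentProj x (stdVec i)), tangentProj x (stdVec i)⟫ =
      ⟪A (stdVec i), stdVec i⟫ - ⟪x, stdVec i⟫ * ⟪A (stdVec i), x⟫ -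
        ⟪x, stdVec i⟫ * ⟪A x, stdVec i⟫ +
        (⟪x, stdVec i⟫ * ⟪x, stdVec i⟫) * ⟪A x, x⟫ := by
    intro i
    simp only [tangentProj, map_sub, map_smul, inner_sub_left, inner_sub_right, inner_smul_left,
      inner_smul_right, conj_trivial]
    ring
  simp only [h, Finset.sum_add_distrib, Finset.sum_sub_distrib, ← Finset.sum_mul, h1, h2, h3,
    real_inner_comm x (A x)]
  ring

theorem hasFDerivAt_tangentProj_map (A : E3 →L[ℝ] E3) (x : E3) :
    HasFDerivAt (fun z => tangentProj z (A z))
      (A - (⟪x, A x⟫ • ContinuousLinearMap.id ℝ E3 +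
        (innerSL ℝ x ∘L A + innerSL ℝ (A x)).smulRight x)) x := by
  have h1 : HasFDerivAt (fun z : E3 => ⟪z, A z⟫) (innerSL ℝ x ∘L A + innerSL ℝ (A x)) x := by
    refine ((hasFDerivAt_id x).inner ℝ A.hasFDerivAt).congr_fderiv ?_
    ext w
    simp [fderivInnerCLM_apply, real_inner_comm]
  exact A.hasFDerivAt.sub (h1.smul (hasFDerivAt_id x))

/-- Product rule. In the factor `3`, one `⟪x, A x⟫` is the normal entry missing from the tangential
trace of `A`; the other two come from differentiating `z` in `⟪z, A z⟫ • z` over a two-dimensional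
tangent plane. -/
theorem surfaceDiv_smul_tangentProj {g : E3 → ℝ} {x : E3} (hg : DifferentiableAt ℝ g x)
    (hx : ‖x‖ = 1) (A : E3 →L[ℝ] E3) :
    surfaceDiv (fun z => g z • tangentProj z (A z)) x =
      fderiv ℝ g x (tangentProj x (A x)) +
        g x * (∑ i, ⟪A (stdVec i), stdVec i⟫ - 3 * ⟪x, A x⟫) := by
  have hd := hg.hasFDerivAt.smul (hasFDerivAt_tangentProj_map A x)
  rw [surfaceDiv, show fderiv ℝ (fun z => g z • tangentProj z (A z)) x = _ from hd.fderiv]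
  have hxu : ∀ i, ⟪x, tangentProj x (stdVec i)⟫ = 0 := fun i => by
    rw [real_inner_comm, inner_tangentProj_self hx]
  have h1 : ∑ i, fderiv ℝ g x (tangentProj x (stdVec i)) *
      ⟪tangentProj x (A x), tangentProj x (stdVec i)⟫ = fderiv ℝ g x (tangentProj x (A x)) := by
    have h0 : tangentProj x (tangentProj x (A x)) = tangentProj x (A x) := by
      rw [tangentProj, real_inner_comm, inner_tangentProj_self hx, zero_smul, sub_zero]
    conv_rhs => rw [← h0, ← sum_inner_tangentProj_smul, map_sum]
    refine Finset.sum_congr rfl fun i _ => ?_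
    rw [inner_tangentProj_tangentProj hx, map_smul, smul_eq_mul, mul_comm, real_inner_comm]
  have h2 : ∑ i, ⟪tangentProj x (stdVec i), tangentProj x (stdVec i)⟫ = (2 : ℝ) := by
    have := sum_inner_map_tangentProj hx (ContinuousLinearMap.id ℝ E3)
    simp only [ContinuousLinearMap.id_apply] at this
    rw [this, real_inner_self_eq_norm_sq, hx]
    simp
    norm_num
  have h : ∀ i, ⟪(g x • (A - (⟪x, A x⟫ • ContinuousLinearMap.id ℝ E3 +
        (innerSL ℝ x ∘L A + innerSL ℝ (A x)).smulRight x)) +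
          (fderiv ℝ g x).smulRight (tangentProj x (A x))) (tangentProj x (stdVec i)),
        tangentProj x (stdVec i)⟫ =
      fderiv ℝ g x (tangentProj x (stdVec i)) *
        ⟪tangentProj x (A x), tangentProj x (stdVec i)⟫ +
      g x * (⟪A (tangentProj x (stdVec i)), tangentProj x (stdVec i)⟫ -
        ⟪x, A x⟫ * ⟪tangentProj x (stdVec i), tangentProj x (stdVec i)⟫) := by
    intro i
    simp only [_root_.add_apply, _root_.smul_apply,
      _root_.sub_apply, ContinuousLinearMap.id_apply,
      ContinuousLinearMap.smulRight_apply, inner_add_left, inner_sub_left, inner_smul_left,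
      conj_trivial, hxu]
    ring
  rw [Finset.sum_congr rfl fun i _ => h i, Finset.sum_add_distrib, h1, ← Finset.mul_sum,
    Finset.sum_sub_distrib, ← Finset.mul_sum, h2, sum_inner_map_tangentProj hx]
  ring

/-! ### Homogeneous extension of test functions -/

/-- The extension of the restriction of `g` to the unit sphere which is homogeneous of
degree `-3`. -/
noncomputable def homogExt (g : E3 → ℝ) (z : E3) : ℝ := (‖z‖⁻¹) ^ 3 * g (‖z‖⁻¹ • z)

theorem homogExt_coe (g : E3 → ℝ) (x : S2) : homogExt g x = g x := by
  simp [homogExt]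

/-- The reason for degree `-3`: the Jacobian density is absorbed, and the dependence on `E` becomes
a linear substitution. -/
theorem homogExt_toEuclideanLin (g : E3 → ℝ) (E : Matrix.SpecialLinearGroup (Fin 3) ℝ) (y : S2) :
    homogExt g (toEuclideanLin E.1 y) = rhoDensity E y * g (rho E⁻¹ y) := by
  simp [homogExt, rhoDensity, coe_rho]

theorem contDiffAt_homogExt {g : E3 → ℝ} (hg : ContDiff ℝ ∞ g) {z : E3} (hz : z ≠ 0) :
    ContDiffAt ℝ ∞ (homogExt g) z := by
  have h : ContDiffAt ℝ ∞ (fun z : E3 => ‖z‖⁻¹) z :=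
    (contDiffAt_norm ℝ hz).inv (norm_ne_zero_iff.mpr hz)
  exact (h.pow 3).mul (hg.contDiffAt.comp z (h.smul contDiffAt_id))

theorem hasFDerivAt_inv_norm {x : E3} (hx : ‖x‖ = 1) :
    HasFDerivAt (fun z : E3 => ‖z‖⁻¹) (-innerSL ℝ x) x := by
  have h1 : HasFDerivAt (fun z : E3 => ‖z‖ ^ 2) (2 • innerSL ℝ x) x :=
    (hasStrictFDerivAt_norm_sq x).hasFDerivAt
  have h2 := h1.sqrt (by simp [hx])
  have h3 : HasFDerivAt (fun z : E3 => ‖z‖) (innerSL ℝ x) x := by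
    refine (h2.congr_of_eventuallyEq (Eventually.of_forall fun z => ?_)).congr_fderiv ?_
    · simp
    · ext w
      simp [hx]
  refine ((hasDerivAt_inv (by simp [hx])).comp_hasFDerivAt x h3).congr_fderiv ?_
  ext w
  simp [hx]

/-- The radial part is Euler's identity in degree `-3`. For `w = A x` with `tr A = 0` this is
exactly the divergence in `surfaceDiv_smul_tangentProj`. -/
theorem fderiv_homogExt {g : E3 → ℝ} {x : E3} (hg : DifferentiableAt ℝ g x) (hx : ‖x‖ = 1)
    (w : E3) :
    fderiv ℝ (homogExt g) x w = fderiv ℝ g x (tangentProj x w) - 3 * ⟪x, w⟫ * g x := by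
  have h := hasFDerivAt_inv_norm hx
  have hx1 : ‖x‖⁻¹ • x = x := by simp [hx]
  have hg' : HasFDerivAt g (fderiv ℝ g x) (‖x‖⁻¹ • x) := by rw [hx1]; exact hg.hasFDerivAt
  have h1 : HasFDerivAt (fun z : E3 => ‖z‖⁻¹ • z) _ x := h.smul (hasFDerivAt_id x)
  have h2 := (h.pow 3).mul (HasFDerivAt.comp (f := fun z : E3 => ‖z‖⁻¹ • z) x hg' h1)
  rw [show fderiv ℝ (homogExt g) x = _ from h2.fderiv]
  simp [hx, tangentProj, map_sub, map_neg]
  ring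

/-- Balls of radius `1/2` about points of the sphere stay in the compact shell `1/2 ≤ |z| ≤ 2`, away
from the singularity at the origin; the derivative is bounded there. This supplies the dominating
function below. -/
theorem exists_homogExt_add_sub_le {g : E3 → ℝ} (hg : ContDiff ℝ ∞ g) :
    ∃ C : ℝ, 0 ≤ C ∧ ∀ (y : S2) (w : E3), ‖w‖ ≤ 1 / 2 →
      |homogExt g (y + w) - homogExt g y| ≤ C * ‖w‖ := by
  have hK : IsCompact (closedBall (0 : E3) 2 \ ball 0 (1 / 2)) :=
    (isCompact_closedBall _ _).diff isOpen_ball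
  have h0 : ∀ z ∈ closedBall (0 : E3) 2 \ ball 0 (1 / 2), z ≠ 0 := by
    rintro z hz rfl
    exact hz.2 (mem_ball_self (by norm_num))
  have hc : ContinuousOn (fderiv ℝ (homogExt g)) (closedBall (0 : E3) 2 \ ball 0 (1 / 2)) :=
    fun z hz => ((contDiffAt_homogExt hg (h0 z hz)).fderiv_right (m := 0)
      (by norm_num)).continuousAt.continuousWithinAt
  obtain ⟨C, hC⟩ := hK.exists_bound_of_continuousOn hc
  have hsub : ∀ y : S2, closedBall (y : E3) (1 / 2) ⊆ closedBall (0 : E3) 2 \ ball 0 (1 / 2) := by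
    intro y z hz
    have hy := norm_eq_of_mem_sphere y
    rw [mem_closedBall, dist_eq_norm] at hz
    have h1 := norm_sub_norm_le z (y : E3)
    have h2 := norm_sub_norm_le (y : E3) z
    rw [norm_sub_rev] at h2
    simp only [Set.mem_sdiff, mem_closedBall, mem_ball, dist_zero_right, not_lt]
    constructor <;> linarith
  refine ⟨max C 0, le_max_right _ _, fun y w hw => ?_⟩
  have := (convex_closedBall (y : E3) (1 / 2)).norm_image_sub_le_of_norm_fderiv_le
    (f := homogExt g) (C := max C 0) (x := (y : E3)) (y := y + w)
    (fun z hz => (contDiffAt_homogExt hg (h0 z (hsub y hz))).differentiableAt (by norm_num))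
    (fun z hz => (hC z (hsub y hz)).trans (le_max_left _ _))
    (mem_closedBall_self (by norm_num)) (by simpa using hw)
  simpa using this

theorem integral_mul_fderiv_homogExt_eq_zero {h : S2 → ℝ} (hh : Integrable h area) {g : E3 → ℝ}
    (hg : ContDiff ℝ ∞ g) {ε : ℕ → ℝ} (hε : ∀ n, ε n ≠ 0) (hε0 : Tendsto ε atTop (𝓝 0))
    {A : ℕ → E3 →L[ℝ] E3} {B : E3 →L[ℝ] E3} (hA : Tendsto A atTop (𝓝 B))
    (hint : ∀ n, ∫ y, h y * homogExt g (y + ε n • A n y) ∂area = ∫ y, h y * g y ∂area) :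
    ∫ y, h y * fderiv ℝ (homogExt g) y (B y) ∂area = 0 := by
  obtain ⟨C, hC0, hC⟩ := exists_homogExt_add_sub_le hg
  have hsm : ∀ᶠ n in atTop, ‖ε n • A n‖ ≤ 1 / 2 := by
    have : Tendsto (fun n => ‖ε n • A n‖) atTop (𝓝 0) := by
      simp only [norm_smul]
      simpa using hε0.norm.mul hA.norm
    exact this.eventually_le_const (by norm_num)
  have hbd : ∀ᶠ n in atTop, ‖A n‖ ≤ ‖B‖ + 1 :=
    hA.norm.eventually_le_const (by linarith)
  have hw : ∀ n (y : S2), ‖ε n • A n y‖ ≤ ‖ε n • A n‖ := fun n y => by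
    simpa using (ε n • A n).le_opNorm (y : E3)
  have hgc : Continuous fun y : S2 => homogExt g y := by
    simp only [homogExt_coe]
    exact hg.continuous.comp continuous_subtype_val
  have hcn : ∀ n, ‖ε n • A n‖ ≤ 1 / 2 →
      Continuous fun y : S2 => homogExt g (y + ε n • A n y) := by
    intro n hn
    rw [continuous_iff_continuousAt]
    intro y
    have hne : (y : E3) + ε n • A n y ≠ 0 := by
      intro h0
      have h1 := hw n y
      have h2 : ‖ε n • A n y‖ = 1 := by
        rw [← neg_eq_of_add_eq_zero_right h0, norm_neg, norm_eq_of_mem_sphere]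
      linarith
    exact ContinuousAt.comp (f := fun y : S2 => (y : E3) + ε n • A n y)
      (contDiffAt_homogExt hg hne).continuousAt (by fun_prop)
  have hlim : Tendsto (fun n => ∫ y, h y *
      ((ε n)⁻¹ * (homogExt g (y + ε n • A n y) - homogExt g y)) ∂area) atTop
      (𝓝 (∫ y, h y * fderiv ℝ (homogExt g) y (B y) ∂area)) := by
    refine tendsto_integral_filter_of_dominated_convergence
      (fun y => ‖h y‖ * (C * (‖B‖ + 1))) ?_ ?_ (hh.norm.mul_const _) ?_
    · filter_upwards [hsm] with n hn
      exact hh.aestronglyMeasurable.mul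
        (continuous_const.mul ((hcn n hn).sub hgc)).aestronglyMeasurable
    · filter_upwards [hsm, hbd] with n hn hn'
      refine Eventually.of_forall fun y => ?_
      rw [norm_mul]
      gcongr
      rw [norm_mul, norm_inv, inv_mul_le_iff₀ (norm_pos_iff.mpr (hε n))]
      calc ‖homogExt g (y + ε n • A n y) - homogExt g y‖
          ≤ C * ‖ε n • A n y‖ := hC y _ ((hw n y).trans hn)
        _ ≤ C * ‖ε n • A n‖ := by gcongr; exact hw n y
        _ = C * (‖ε n‖ * ‖A n‖) := by rw [norm_smul]
        _ ≤ C * (‖ε n‖ * (‖B‖ + 1)) := by gcongr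
        _ = ‖ε n‖ * (C * (‖B‖ + 1)) := by ring
    · refine Eventually.of_forall fun y => Tendsto.const_mul _ ?_
      have hy := ((contDiffAt_homogExt hg (ne_zero_of_mem_unit_sphere y)).differentiableAt
        (by norm_num)).hasFDerivAt
      have hAy : Tendsto (fun n => A n (y : E3)) atTop (𝓝 (B y)) :=
        ((ContinuousLinearMap.apply ℝ E3 (y : E3)).continuous.tendsto B).comp hA
      -- The direction `A n y` varies with `n`; it suffices that `(ε n)⁻¹` times the increment tends
      -- to `B y`.
      refine hy.hasFDerivWithinAt.lim (s := univ) (c := fun n => (ε n)⁻¹)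
        (d := fun n => ε n • A n y) ?_ (by simp) ?_
      · simpa using hε0.smul hAy
      · simpa only [smul_smul, inv_mul_cancel₀ (hε _), one_smul] using hAy
  refine tendsto_nhds_unique hlim (tendsto_const_nhds.congr' ?_)
  filter_upwards [hsm] with n hn
  have hint1 : ∀ k : S2 → ℝ, Continuous k → Integrable (fun y => h y * k y) area := by
    intro k hk
    obtain ⟨D, hD⟩ := isCompact_univ.exists_bound_of_continuousOn hk.continuousOn
    exact hh.mul_bdd (c := D) hk.aestronglyMeasurable
      (Eventually.of_forall fun y => hD y (mem_univ y))
  have e : ∀ y : S2, h y * ((ε n)⁻¹ * (homogExt g (y + ε n • A n y) - homogExt g y)) =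
      (ε n)⁻¹ * (h y * homogExt g (y + ε n • A n y) - h y * homogExt g y) := fun y => by ring
  simp only [e]
  rw [integral_const_mul, integral_sub (hint1 _ (hcn n hn)) (hint1 _ hgc), hint n]
  simp [homogExt_coe]

/-! ### Tangent directions of `SL(3)` at the identity -/

/-- The sum of the principal `2 × 2` minors of a `3 × 3` matrix. -/
def principalMinors (M : Matrix (Fin 3) (Fin 3) ℝ) : ℝ :=
  M 0 0 * M 1 1 - M 0 1 * M 1 0 + (M 0 0 * M 2 2 - M 0 2 * M 2 0) +
    (M 1 1 * M 2 2 - M 1 2 * M 2 1)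

theorem det_one_add_smul_fin_three (ε : ℝ) (M : Matrix (Fin 3) (Fin 3) ℝ) :
    (1 + ε • M).det = 1 + ε * (M.trace + ε * (principalMinors M + ε * M.det)) := by
  simp only [det_fin_three, trace_fin_three, principalMinors, Matrix.add_apply, Matrix.smul_apply,
    smul_eq_mul, one_apply]
  simp
  ring

theorem trace_eq_zero_of_tendsto {ε : ℕ → ℝ} (hε : ∀ n, ε n ≠ 0) (hε0 : Tendsto ε atTop (𝓝 0))
    {D : ℕ → Matrix (Fin 3) (Fin 3) ℝ} {Δ : Matrix (Fin 3) (Fin 3) ℝ}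
    (hD : Tendsto D atTop (𝓝 Δ)) (hdet : ∀ n, (1 + ε n • D n).det = 1) : Δ.trace = 0 := by
  have h : ∀ n, (D n).trace + ε n * (principalMinors (D n) + ε n * (D n).det) = 0 := fun n => by
    have := hdet n
    rw [det_one_add_smul_fin_three] at this
    exact (mul_eq_zero.mp (add_eq_left.mp this)).resolve_left (hε n)
  have ht : Tendsto (fun n => (D n).trace) atTop (𝓝 Δ.trace) :=
    ((continuous_id.matrix_trace).tendsto Δ).comp hD
  have hd : Tendsto (fun n => (D n).det) atTop (𝓝 Δ.det) :=
    ((continuous_id.matrix_det).tendsto Δ).comp hD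
  have hm : Tendsto (fun n => principalMinors (D n)) atTop (𝓝 (principalMinors Δ)) := by
    have : Continuous principalMinors := by
      unfold principalMinors
      fun_prop
    exact (this.tendsto Δ).comp hD
  have := ht.add (hε0.mul (hm.add (hε0.mul hd)))
  simp only [h, zero_mul, add_zero] at this
  exact (tendsto_nhds_unique this tendsto_const_nhds)

/-- Needed to extract a sequence from a property that holds frequently near the identity. -/
instance instFirstCountableTopologySpecialLinearGroup :
    FirstCountableTopology (Matrix.SpecialLinearGroup (Fin 3) ℝ) :=
  haveI : FirstCountableTopology (Matrix (Fin 3) (Fin 3) ℝ) :=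
    inferInstanceAs (FirstCountableTopology (Fin 3 → Fin 3 → ℝ))
  (IsInducing.subtypeVal : IsInducing
    (Subtype.val : {A : Matrix (Fin 3) (Fin 3) ℝ // A.det = 1} → _)).firstCountableTopology

/-- Elements of `SL(3)` accumulating at the identity have, up to a subsequence, a tangent
direction at the identity. -/
theorem exists_tangent_direction {p : Matrix.SpecialLinearGroup (Fin 3) ℝ → Prop}
    (hp : ∃ᶠ E in 𝓝[≠] 1, p E) :
    ∃ (E : ℕ → Matrix.SpecialLinearGroup (Fin 3) ℝ) (ε : ℕ → ℝ) (A : ℕ → E3 →L[ℝ] E3)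
      (Δ : Matrix (Fin 3) (Fin 3) ℝ),
      (∀ n, p (E n)) ∧ (∀ n, ε n ≠ 0) ∧ Tendsto ε atTop (𝓝 0) ∧
      Tendsto A atTop (𝓝 (toEuclideanCLM (𝕜 := ℝ) Δ)) ∧
      (∀ n x, toEuclideanLin (E n).1 x = x + ε n • A n x) ∧ Δ.trace = 0 ∧ Δ ≠ 0 := by
  obtain ⟨E, hE, hpE⟩ := exists_seq_forall_of_frequently
    (hp.and_eventually eventually_mem_nhdsWithin)
  have hE1 : Tendsto E atTop (𝓝 1) := hE.mono_right nhdsWithin_le_nhds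
  have hcont : Continuous fun M : Matrix (Fin 3) (Fin 3) ℝ => toEuclideanCLM (𝕜 := ℝ) M :=
    LinearMap.continuous_of_finiteDimensional
      (toEuclideanCLM (n := Fin 3) (𝕜 := ℝ)).toAlgEquiv.toLinearMap
  have hcont' : Continuous fun A : E3 →L[ℝ] E3 => (toEuclideanCLM (n := Fin 3) (𝕜 := ℝ)).symm A :=
    LinearMap.continuous_of_finiteDimensional
      (toEuclideanCLM (n := Fin 3) (𝕜 := ℝ)).symm.toAlgEquiv.toLinearMap
  let K : ℕ → E3 →L[ℝ] E3 := fun n => toEuclideanCLM (𝕜 := ℝ) ((E n).1 - 1)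
  have hK0 : ∀ n, K n ≠ 0 := by
    intro n h
    have h1 : (E n).1 - 1 = 0 := (toEuclideanCLM (n := Fin 3) (𝕜 := ℝ)).injective
      (h.trans (map_zero _).symm)
    exact (hpE n).2 (Subtype.ext (sub_eq_zero.mp h1))
  have hKlim : Tendsto K atTop (𝓝 0) := by
    have h1 : Tendsto (fun n => (E n).1 - 1) atTop (𝓝 0) := by
      have h0 : Tendsto (fun n => (E n).1 - 1) atTop
          (𝓝 ((1 : Matrix.SpecialLinearGroup (Fin 3) ℝ).1 - 1)) :=
        ((continuous_subtype_val.tendsto _).comp hE1).sub_const _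
      have h1 : (1 : Matrix.SpecialLinearGroup (Fin 3) ℝ).1 - 1 = 0 := sub_self _
      rwa [h1] at h0
    have h2 := (hcont.tendsto 0).comp h1
    rwa [map_zero] at h2
  have : ProperSpace (E3 →L[ℝ] E3) := FiniteDimensional.proper ℝ _
  -- The differences `E n - 1` are normalised in operator norm, so the limit has norm one and cannot
  -- vanish.
  obtain ⟨B, hB, φ, hφ, hlim⟩ := (isCompact_sphere (0 : E3 →L[ℝ] E3) 1).tendsto_subseq
    (x := fun n => ‖K n‖⁻¹ • K n) (fun n => by
      rw [mem_sphere_zero_iff_norm, norm_smul, norm_inv, norm_norm]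
      exact inv_mul_cancel₀ (norm_ne_zero_iff.mpr (hK0 n)))
  have hε : ∀ n, ‖K (φ n)‖ ≠ 0 := fun n => norm_ne_zero_iff.mpr (hK0 _)
  have hε0 : Tendsto (fun n => ‖K (φ n)‖) atTop (𝓝 0) := by
    simpa using (hKlim.comp hφ.tendsto_atTop).norm
  have hs : ∀ n, ‖K (φ n)‖ • (toEuclideanCLM (n := Fin 3) (𝕜 := ℝ)).symm
      (‖K (φ n)‖⁻¹ • K (φ n)) = (E (φ n)).1 - 1 := by
    intro n
    rw [← map_smul, smul_smul, mul_inv_cancel₀ (hε n), one_smul, StarAlgEquiv.symm_apply_apply]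
  refine ⟨fun n => E (φ n), fun n => ‖K (φ n)‖, fun n => ‖K (φ n)‖⁻¹ • K (φ n),
    (toEuclideanCLM (n := Fin 3) (𝕜 := ℝ)).symm B, fun n => (hpE _).1, hε, hε0, ?_, ?_, ?_, ?_⟩
  · rw [StarAlgEquiv.apply_symm_apply]
    exact hlim
  · intro n x
    rw [_root_.smul_apply, smul_smul, mul_inv_cancel₀ (hε n), one_smul]
    have : K (φ n) x = toEuclideanLin (E (φ n)).1 x - x := by
      simp only [K, map_sub, map_one]
      rfl
    rw [this, add_sub_cancel]
  · refine trace_eq_zero_of_tendsto hε hε0 ((hcont'.tendsto B).comp hlim) fun n => ?_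
    simp only [Function.comp_apply]
    rw [hs, add_sub_cancel]
    exact (E (φ n)).2
  · intro h
    have hB0 : B = 0 := by
      rw [← StarAlgEquiv.apply_symm_apply (toEuclideanCLM (n := Fin 3) (𝕜 := ℝ)) B, h, map_zero]
    rw [hB0] at hB
    simp at hB

/-! ### Zero cost and its infinitesimal consequence -/

theorem trace_eq_sum_inner (Δ : Matrix (Fin 3) (Fin 3) ℝ) :
    ∑ i, ⟪toEuclideanCLM (𝕜 := ℝ) Δ (stdVec i), stdVec i⟫ = Δ.trace := by
  simp [EuclideanSpace.inner_single_right, trace]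

theorem frobeniusInner_vecMulVec (v : E3) (x : E3) (Δ : Matrix (Fin 3) (Fin 3) ℝ) :
    frobeniusInner (vecMulVec v.ofLp x.ofLp) Δ = ⟪v, toEuclideanCLM (𝕜 := ℝ) Δ x⟫ := by
  simp [frobeniusInner, trace_fin_three, Matrix.mul_apply, vecMulVec_apply, PiLp.inner_apply,
    Fin.sum_univ_three, mulVec, dotProduct]
  ring

theorem warpedImage_eq_indicator (X : Set S2) (f : S2 → ℝ)
    (E : Matrix.SpecialLinearGroup (Fin 3) ℝ) (x : S2) :
    warpedImage X f E x = X.indicator f (rho E x) := by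
  classical
  by_cases h : rho E x ∈ X <;> simp [warpedImage, h]

theorem photometricCost_nonneg (X : Set S2) (f : S2 → ℝ)
    (E : Matrix.SpecialLinearGroup (Fin 3) ℝ) : 0 ≤ photometricCost X f E :=
  mul_nonneg (by norm_num) (integral_nonneg fun _ => sq_nonneg _)

theorem photometricCost_one {X : Set S2} (hX : MeasurableSet X) (f : S2 → ℝ) :
    photometricCost X f 1 = 0 := by
  have : ∫ x in X, (warpedImage X f 1 x - f x) ^ 2 ∂area = ∫ x in X, (0 : ℝ) ∂area := by
    refine setIntegral_congr_fun hX fun x hx => ?_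
    simp [warpedImage, rho_one, hx]
  rw [photometricCost, this]
  simp

theorem ae_eq_of_photometricCost_eq_zero {X : Set S2} (hX : MeasurableSet X) {f : S2 → ℝ}
    (hf : MemLp f 2 (area.restrict X)) {E : Matrix.SpecialLinearGroup (Fin 3) ℝ}
    (h : photometricCost X f E = 0) :
    ∀ᵐ x ∂area, x ∈ X → X.indicator f (rho E x) = f x := by
  have hi : MemLp (X.indicator f) 2 area := (memLp_indicator_iff_restrict hX).2 hf
  have hd : MemLp (fun x => warpedImage X f E x - f x) 2 (area.restrict X) := by
    simp only [warpedImage_eq_indicator]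
    exact ((memLp_comp_rho hi E).restrict X).sub hf
  have h0 : ∫ x in X, (warpedImage X f E x - f x) ^ 2 ∂area = 0 := by
    simpa [photometricCost] using h
  rw [integral_eq_zero_iff_of_nonneg (fun _ => sq_nonneg _) hd.integrable_sq] at h0
  rw [← ae_restrict_iff' hX]
  filter_upwards [h0] with x hx
  rw [← warpedImage_eq_indicator]
  exact sub_eq_zero.mp (pow_eq_zero_iff two_ne_zero |>.mp hx)

/-- Substituting along `rho E` moves the warp from the test function to the image, where invariance
removes it. Invariance is known only on `X`, which suffices because `g` vanishes elsewhere on the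
sphere. -/
theorem integral_indicator_mul_homogExt {X : Set S2} {f : S2 → ℝ}
    {E : Matrix.SpecialLinearGroup (Fin 3) ℝ}
    (h : ∀ᵐ x ∂area, x ∈ X → X.indicator f (rho E x) = f x) {g : E3 → ℝ}
    (hg : ∀ x : S2, x ∉ X → g x = 0) :
    ∫ y, X.indicator f y * homogExt g (toEuclideanLin E.1 y) ∂area =
      ∫ y, X.indicator f y * g y ∂area := by
  have h1 := integral_comp_rho E fun y => X.indicator f y * g (rho E⁻¹ y)
  simp only [rho_inv_rho] at h1
  calc ∫ y, X.indicator f y * homogExt g (toEuclideanLin E.1 y) ∂area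
      = ∫ y, rhoDensity E y * (X.indicator f y * g (rho E⁻¹ y)) ∂area := by
        refine integral_congr_ae (Eventually.of_forall fun y => ?_)
        simp only [homogExt_toEuclideanLin]
        ring
    _ = ∫ y, X.indicator f (rho E y) * g y ∂area := h1.symm
    _ = ∫ y, X.indicator f y * g y ∂area := by
        refine integral_congr_ae ?_
        filter_upwards [h] with y hy
        by_cases hyX : y ∈ X
        · simp only [hy hyX, indicator_of_mem hyX]
        · simp only [hg y hyX, mul_zero]

theorem isTestField_smul_tangentProj {X : Set S2} {g : E3 → ℝ} (hg : ContDiff ℝ ∞ g)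
    (hX : tsupport (fun x : S2 => g x) ⊆ X) (A : E3 →L[ℝ] E3) :
    IsTestField X fun z => g z • tangentProj z (A z) := by
  refine ⟨?_, fun x => ?_, ?_⟩
  · unfold tangentProj
    exact hg.smul (A.contDiff.sub ((contDiff_id.inner ℝ A.contDiff).smul contDiff_id))
  · rw [inner_smul_left, inner_tangentProj_self (norm_eq_of_mem_sphere x), mul_zero]
  · exact (closure_mono (Function.support_smul_subset_left (fun x : S2 => g x) _)).trans hX

/-- The distributional derivative vanishes along the infinitesimal generator of a sequence of
warps that leave the image unchanged. -/
theorem setIntegral_mul_inner_eq_zero {X : Set S2} (hX : MeasurableSet X) {f : S2 → ℝ}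
    (hf : MemLp f 2 (area.restrict X)) {G : S2 → E3} (hG : IsWeakGradient X f G)
    {E : ℕ → Matrix.SpecialLinearGroup (Fin 3) ℝ} {ε : ℕ → ℝ} {A : ℕ → E3 →L[ℝ] E3}
    {Δ : Matrix (Fin 3) (Fin 3) ℝ} (hE : ∀ n, photometricCost X f (E n) = 0)
    (hε : ∀ n, ε n ≠ 0) (hε0 : Tendsto ε atTop (𝓝 0))
    (hA : Tendsto A atTop (𝓝 (toEuclideanCLM (𝕜 := ℝ) Δ)))
    (hEA : ∀ n x, toEuclideanLin (E n).1 x = x + ε n • A n x) (hΔ : Δ.trace = 0)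
    {g : E3 → ℝ} (hg : ContDiff ℝ ∞ g) (hgX : tsupport (fun x : S2 => g x) ⊆ X) :
    ∫ x in X, g x * ⟪G x, toEuclideanCLM (𝕜 := ℝ) Δ x⟫ ∂area = 0 := by
  have hg0 : ∀ x : S2, x ∉ X → g x = 0 := fun x hx =>
    image_eq_zero_of_notMem_tsupport (f := fun x : S2 => g x) fun h => hx (hgX h)
  have hi : Integrable (X.indicator f) area :=
    ((memLp_indicator_iff_restrict hX).2 hf).integrable (by norm_num)
  have h1 := integral_mul_fderiv_homogExt_eq_zero hi hg hε hε0 hA fun n => by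
    simp only [← hEA]
    exact integral_indicator_mul_homogExt (ae_eq_of_photometricCost_eq_zero hX hf (hE n)) hg0
  have h2 := hG.2.2.2 _ (isTestField_smul_tangentProj hg hgX (toEuclideanCLM (𝕜 := ℝ) Δ))
  have h3 : ∫ x in X, f x * surfaceDiv
      (fun z => g z • tangentProj z (toEuclideanCLM (𝕜 := ℝ) Δ z)) x ∂area = 0 := by
    rw [← h1, ← integral_indicator hX]
    refine integral_congr_ae (Eventually.of_forall fun x => ?_)
    by_cases hx : x ∈ X
    · have hn := norm_eq_of_mem_sphere x
      have hd : DifferentiableAt ℝ g x := hg.differentiable (by norm_num) _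
      simp only [indicator_of_mem hx]
      -- With trace zero, divergence and derivative of the homogeneous extension coincide.
      rw [surfaceDiv_smul_tangentProj hd hn, fderiv_homogExt hd hn, trace_eq_sum_inner, hΔ]
      ring
    · simp [hx]
  rw [h3, eq_comm, neg_eq_zero] at h2
  rw [← h2]
  refine integral_congr_ae ?_
  filter_upwards [hG.2.2.1] with x hx
  -- `G` is tangential, so the projection inside the test field can be dropped.
  rw [tangentProj, inner_smul_right, inner_sub_right, inner_smul_right, hx]
  ring

/-! ### The fundamental lemma on the sphere and the conclusion -/

/-- A locally integrable function on an open subset of the sphere vanishes almost everywhere if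
it is orthogonal to the restrictions of all smooth functions with support in the subset. -/
theorem ae_eq_zero_of_setIntegral_contDiff_mul_eq_zero {X : Set S2} (hX : IsOpen X) {k : S2 → ℝ}
    (hk : LocallyIntegrableOn k X area)
    (h : ∀ g : E3 → ℝ, ContDiff ℝ ∞ g → tsupport (fun x : S2 => g x) ⊆ X →
      ∫ x in X, g x * k x ∂area = 0) :
    ∀ᵐ x ∂area, x ∈ X → k x = 0 := by
  obtain ⟨U, hU, rfl⟩ := isOpen_induced_iff.1 hX
  have hme : MeasurableEmbedding (Subtype.val : S2 → E3) :=
    MeasurableEmbedding.subtype_coe isClosed_sphere.measurableSet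
  -- The claim is transported to the ambient space: `k` is extended by zero and the area measure is
  -- pushed forward, so that the Euclidean fundamental lemma applies to a measure carried by the
  -- sphere. Off the sphere, local integrability is trivial, since the complement is null.
  let k' : E3 → ℝ := Function.extend Subtype.val k 0
  have hk' : ∀ x : S2, k' x = k x := fun x => Subtype.val_injective.extend_apply _ _ _
  have hloc : LocallyIntegrableOn k' U (area.map Subtype.val) := by
    intro z hz
    by_cases hzS : z ∈ sphere (0 : E3) 1
    · obtain ⟨V, hV, hVi⟩ := hk ⟨z, hzS⟩ hz
      rw [hX.nhdsWithin_eq hz, nhds_subtype_eq_comap] at hV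
      obtain ⟨W, hW, hWV⟩ := hV
      refine ⟨W, mem_nhdsWithin_of_mem_nhds hW, ?_⟩
      rw [hme.integrableOn_map_iff]
      have : k' ∘ Subtype.val = k := funext hk'
      rw [this]
      exact hVi.mono_set hWV
    · refine ⟨(sphere (0 : E3) 1)ᶜ, mem_nhdsWithin_of_mem_nhds
        (isClosed_sphere.isOpen_compl.mem_nhds hzS), ?_⟩
      rw [hme.integrableOn_map_iff]
      have : (Subtype.val : S2 → E3) ⁻¹' (sphere (0 : E3) 1)ᶜ = ∅ := by
        ext x
        simp
      rw [this]
      exact integrableOn_empty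
  have hz := hU.ae_eq_zero_of_integral_contDiff_smul_eq_zero hloc fun g hg _ hgU => by
    have hts : tsupport (fun x : S2 => g x) ⊆ Subtype.val ⁻¹' U :=
      (tsupport_comp_subset_preimage g continuous_subtype_val).trans (preimage_mono hgU)
    rw [hme.integral_map, ← h g hg hts, setIntegral_eq_integral_of_forall_compl_eq_zero]
    · simp only [hk', smul_eq_mul]
    · intro x hx
      rw [image_eq_zero_of_notMem_tsupport (f := fun x : S2 => g x) fun h => hx (hts h),
        zero_mul]
  rw [hme.ae_map_iff] at hz
  filter_upwards [hz] with x hx hxU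
  rw [← hk' x]
  exact hx hxU

theorem locallyIntegrableOn_inner_map {X : Set S2} {G : S2 → E3}
    (hG : LocallyIntegrableOn G X area) (A : E3 →L[ℝ] E3) :
    LocallyIntegrableOn (fun x : S2 => ⟪G x, A x⟫) X area := by
  intro x hx
  obtain ⟨V, hV, hVi⟩ := hG x hx
  refine ⟨V, hV, (hVi.norm.mul_const ‖A‖).mono' (hVi.aestronglyMeasurable.inner
    (A.continuous.comp continuous_subtype_val).aestronglyMeasurable)
    (Eventually.of_forall fun y => (norm_inner_le_norm _ _).trans ?_)⟩
  gcongr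
  simpa using A.le_opNorm (y : E3)

end Homography

theorem mainTheorem2
    (X : Set Homography.S2) (hX : IsOpen X)
    (f : Homography.S2 → ℝ) (hf : Homography.MemW22 X f)
    (G : Homography.S2 → Homography.E3) (hG : Homography.IsWeakGradient X f G)
    (hU : ∀ Δ : Matrix (Fin 3) (Fin 3) ℝ, Δ.trace = 0 → Δ ≠ 0 →
      ∃ U : Set Homography.S2, MeasurableSet U ∧ U ⊆ X ∧ 0 < Homography.area U ∧
        0 < ∫ x in U, Homography.frobeniusInner
          (Matrix.vecMulVec (G x).ofLp (x : Homography.E3).ofLp) Δ ^ 2 ∂Homography.area) :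
    (∀ E : Matrix.SpecialLinearGroup (Fin 3) ℝ,
      Homography.photometricCost X f 1 ≤ Homography.photometricCost X f E) ∧
    (∀ᶠ E in 𝓝[≠] (1 : Matrix.SpecialLinearGroup (Fin 3) ℝ),
      Homography.photometricCost X f 1 < Homography.photometricCost X f E) := by
  rw [Homography.photometricCost_one hX.measurableSet]
  refine ⟨Homography.photometricCost_nonneg X f, ?_⟩
  by_contra hcon
  obtain ⟨E, ε, A, Δ, hE, hε, hε0, hA, hEA, htr, hΔ⟩ :=
    -- Failure of isolation means that matrices of nonpositive, hence zero, cost accumulate at the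
    -- identity.
    Homography.exists_tangent_direction (Filter.not_eventually.mp hcon)
  have hE0 : ∀ n, Homography.photometricCost X f (E n) = 0 := fun n =>
    le_antisymm (not_lt.mp (hE n)) (Homography.photometricCost_nonneg X f _)
  have hae := Homography.ae_eq_zero_of_setIntegral_contDiff_mul_eq_zero hX
    (Homography.locallyIntegrableOn_inner_map hG.2.1 (Matrix.toEuclideanCLM (𝕜 := ℝ) Δ))
    fun g hg hgX => Homography.setIntegral_mul_inner_eq_zero hX.measurableSet hf.1 hG hE0 hε hε0
      hA hEA htr hg hgX
  obtain ⟨U, hUm, hUX, -, hpos⟩ := hU Δ htr hΔ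
  refine hpos.ne' (integral_eq_zero_of_ae ?_)
  rw [Filter.EventuallyEq, ae_restrict_iff' hUm]
  filter_upwards [hae] with x hx hxU
  rw [Homography.frobeniusInner_vecMulVec, hx (hUX hxU)]
  simp
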